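/- For a group $G$ let $\mathcal{L}_G$ be the lattice of all (not necessarily Hausdorff) group topologies on $G$, ordered by $\sigma\le\tau$ if and only if $\tau$ is finer than $\sigma$ (that is, $\sigma\subseteq\tau$). In a lattice write $b\prec a$ ("$a$ covers $b$") if $b<a$ and there is no $c$ with $b<c<a$, and $b\preceq a$ if $b\prec a$ or $b=a$. A lattice is called semi-modular if $b\prec a$ implies $b\vee c\preceq a\vee c$ for all elements $a,b,c$. A chain $C$ refines a chain $D$ if $D\subseteq C$ and every $c\in C$ satisfies $d_1\le c\le d_2$ for some $d_1,d_2\in D$; a chain is non-refinable if no chain other than itself refines it. The length of a finite non-empty chain is the number of its elements minus one. Theorem. Let $G$ be a nilpotent group. Then: (i) the lattice $\mathcal{L}_G$ is semi-modular; (ii) for all $a,b\in\mathcal{L}_G$, any two finite non-refinable chains in $\mathcal{L}_G$ with least element $a$ and greatest element $b$ have the same length. -/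

import Mathlib

/-- The lattice of all (not necessarily Hausdorff) group topologies on the group `G`, in which
`σ ≤ τ` means that `τ` is finer than `σ`. Mathlib's order on topologies is the opposite one
(smaller is finer), hence the order dual. -/
abbrev GroupTopologyLattice (G : Type*) [Group G] : Type _ := (GroupTopology G)ᵒᵈ

/-- The order is inclusion of the families of open sets. -/
theorem GroupTopologyLattice.le_iff {G : Type*} [Group G] (σ τ : GroupTopologyLattice G) :
    σ ≤ τ ↔ ∀ U : Set G, (OrderDual.ofDual σ).toTopologicalSpace.IsOpen U →
      (OrderDual.ofDual τ).toTopologicalSpace.IsOpen U :=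
  Iff.rfl

/-- The upper covering condition: if `a` covers `b`, then for every `c` the join `a ⊔ c` either
covers or equals `b ⊔ c` (in a partial order `x ⩿ y` says that `y` covers or equals `x`). -/
def IsSemimodularLattice (L : Type*) [Lattice L] : Prop :=
  ∀ a b c : L, b ⋖ a → b ⊔ c ⩿ a ⊔ c

/-- `C` refines `D`: it contains `D`, and each of its elements lies between two elements of `D`. -/
def Refines {P : Type*} [PartialOrder P] (C D : Set P) : Prop :=
  D ⊆ C ∧ ∀ c ∈ C, ∃ d₁ ∈ D, ∃ d₂ ∈ D, d₁ ≤ c ∧ c ≤ d₂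

/-- A non-refinable chain: a chain such that no other chain refines it. -/
def IsNonRefinableChain {P : Type*} [PartialOrder P] (C : Set P) : Prop :=
  IsChain (· ≤ ·) C ∧ ∀ D : Set P, IsChain (· ≤ ·) D → Refines D C → D = C

/-- `C` is a non-refinable chain with least element `a` and greatest element `b`. -/
def IsNonRefinableChainBetween {P : Type*} [PartialOrder P] (a b : P) (C : Set P) : Prop :=
  IsNonRefinableChain C ∧ IsLeast C a ∧ IsGreatest C b

/-- The length of a finite non-empty chain: the number of its elements minus one. -/
noncomputable def chainLength {P : Type*} (C : Set P) : ℕ := C.ncard - 1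

/-!
A group topology is determined by its filter of neighbourhoods of `1`, and the filters that occur
are characterised by closure under products, inverses and conjugation. Let `a` cover `b`, with
neighbourhood filters `A ≤ B`. Along the upper central series there are consecutive terms `M ≤ N`
such that `A` and `B` agree modulo `N` but not modulo `M`; since nothing lies strictly between `b`
and `a`, the two topologies then agree on `M`. As `[N, G] ≤ M`, conjugation by `B`-small elements
preserves `A`-smallness. Hence for `d` between `b ⊔ c` and `a ⊔ c`, with neighbourhood filter `D`,
the product filter `D * A` is again a neighbourhood filter. It lies between `A` and `B`, so it is
one of them, and Dedekind's modular law for products of filters gives `d = a ⊔ c` or `d = b ⊔ c`.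

A finite non-refinable chain is a series of covers, so its length is determined by its ends by the
Jordan–Hölder theorem for the dual lattice.
-/

open Filter Set Topology
open scoped Pointwise commutatorElement

section FilterProduct

variable {M : Type*} [Mul M]

theorem tendsto_mul_prod (F F' : Filter M) :
    Tendsto (fun p : M × M => p.1 * p.2) (F ×ˢ F') (F * F') :=
  (map_prod_eq_map₂ (· * ·) F F').le

theorem filter_mul_inf_eq_map (F F' H : Filter M) :
    F * F' ⊓ H = map (fun p : M × M => p.1 * p.2)
      (F ×ˢ F' ⊓ comap (fun p : M × M => p.1 * p.2) H) := by
  rw [Filter.push_pull, map_prod_eq_map₂ (· * ·)]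
  rfl

end FilterProduct

/-- The filters on a group that are the filters of neighbourhoods of `1` in the group topologies,
see `GroupTopologyLattice.exists_nhdsOne_eq`. -/
structure IsGroupFilter {G : Type*} [Group G] (F : Filter G) : Prop where
  one_le : 1 ≤ F
  mul_le : F * F ≤ F
  inv_le : F⁻¹ ≤ F
  tendsto_conj : ∀ g : G, Tendsto (fun x => g * x * g⁻¹) F F

namespace IsGroupFilter

variable {α G : Type*} [Group G] {l : Filter α} {f g : α → G} {A B C D F : Filter G}

theorem tendsto_mul (hF : IsGroupFilter F) (hf : Tendsto f l F) (hg : Tendsto g l F) :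
    Tendsto (fun x => f x * g x) l F :=
  ((tendsto_mul_prod F F).mono_right hF.mul_le).comp (hf.prodMk hg)

theorem tendsto_inv (hF : IsGroupFilter F) (hf : Tendsto f l F) :
    Tendsto (fun x => (f x)⁻¹) l F :=
  Tendsto.comp (g := Inv.inv) hF.inv_le hf

theorem tendsto_commutator (hF : IsGroupFilter F) (hf : Tendsto f l F) (hg : Tendsto g l F) :
    Tendsto (fun x => ⁅f x, g x⁆) l F :=
  hF.tendsto_mul (hF.tendsto_mul (hF.tendsto_mul hf hg) (hF.tendsto_inv hf)) (hF.tendsto_inv hg)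

theorem inf (hA : IsGroupFilter A) (hB : IsGroupFilter B) : IsGroupFilter (A ⊓ B) where
  one_le := le_inf hA.one_le hB.one_le
  mul_le := le_inf ((mul_le_mul' inf_le_left inf_le_left).trans hA.mul_le)
    ((mul_le_mul' inf_le_right inf_le_right).trans hB.mul_le)
  inv_le := le_inf ((Filter.map_mono inf_le_left).trans hA.inv_le)
    ((Filter.map_mono inf_le_right).trans hB.inv_le)
  tendsto_conj g := (hA.tendsto_conj g).inf (hB.tendsto_conj g)

theorem principal (N : Subgroup G) [hN : N.Normal] : IsGroupFilter (𝓟 (N : Set G)) where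
  one_le := by simp
  mul_le := le_principal_iff.2 <| mem_of_superset
    (mul_mem_mul (mem_principal_self _) (mem_principal_self _)) (coe_mul_coe N).subset
  inv_le := tendsto_principal_principal.2 fun _ hx => N.inv_mem hx
  tendsto_conj g := tendsto_principal_principal.2 fun x hx => hN.conj_mem x hx g

theorem mul_le_mul_swap (hA : IsGroupFilter A)
    (h : Tendsto (fun p : G × G => p.1 * p.2 * p.1⁻¹) (A ×ˢ B) B) : B * A ≤ A * B := by
  have hconj : Tendsto (fun p : G × G => p.2 * (p.2⁻¹ * p.1 * p.2⁻¹⁻¹)) (B ×ˢ A) (A * B) :=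
    (tendsto_mul_prod A B).comp
      (tendsto_snd.prodMk (h.comp ((hA.tendsto_inv tendsto_snd).prodMk tendsto_fst)))
  simp only [inv_inv, mul_assoc, mul_inv_cancel_left] at hconj
  exact (map_prod_eq_map₂ (· * ·) B A).ge.trans hconj

theorem mul (hA : IsGroupFilter A) (hB : IsGroupFilter B)
    (h : Tendsto (fun p : G × G => p.1 * p.2 * p.1⁻¹) (A ×ˢ B) B) : IsGroupFilter (A * B) where
  one_le := one_le_mul hA.one_le hB.one_le
  mul_le :=
    calc A * B * (A * B) = A * (B * A) * B := by simp only [mul_assoc]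
      _ ≤ A * (A * B) * B := mul_le_mul' (mul_le_mul' le_rfl (hA.mul_le_mul_swap h)) le_rfl
      _ = A * A * (B * B) := by simp only [mul_assoc]
      _ ≤ A * B := mul_le_mul' hA.mul_le hB.mul_le
  inv_le :=
    calc (A * B)⁻¹ = B⁻¹ * A⁻¹ := mul_inv_rev A B
      _ ≤ B * A := mul_le_mul' hB.inv_le hA.inv_le
      _ ≤ A * B := hA.mul_le_mul_swap h
  tendsto_conj g :=
    calc map (MulAut.conj g) (A * B) = map (MulAut.conj g) A * map (MulAut.conj g) B :=
          Filter.map_mul (MulAut.conj g)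
      _ ≤ A * B := mul_le_mul' (hA.tendsto_conj g) (hB.tendsto_conj g)

theorem mul_principal (hA : IsGroupFilter A) (N : Subgroup G) [hN : N.Normal] :
    IsGroupFilter (A * 𝓟 (N : Set G)) :=
  hA.mul (principal N) <| tendsto_principal.2 <|
    (tendsto_snd.eventually (mem_principal_self _)).mono fun p hp => hN.conj_mem p.2 hp p.1

theorem mul_inf_le_mul_inf (hC : IsGroupFilter C) (hAC : A ≤ C) : A * B ⊓ C ≤ A * (B ⊓ C) := by
  rw [filter_mul_inf_eq_map]
  set l := A ×ˢ B ⊓ comap (fun p : G × G => p.1 * p.2) C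
  have hfst : Tendsto Prod.fst l A := tendsto_fst.mono_left inf_le_left
  have hsnd : Tendsto Prod.snd l B := tendsto_snd.mono_left inf_le_left
  have hmul : Tendsto (fun p : G × G => p.1 * p.2) l C := tendsto_comap.mono_left inf_le_right
  have hsndC : Tendsto Prod.snd l C := by
    simpa only [inv_mul_cancel_left] using
      hC.tendsto_mul (hC.tendsto_inv (hfst.mono_right hAC)) hmul
  exact (tendsto_mul_prod A (B ⊓ C)).comp (hfst.prodMk (tendsto_inf.2 ⟨hsnd, hsndC⟩))

theorem tendsto_conj_prod (hA : IsGroupFilter A) (hB : IsGroupFilter B) (hAB : A ≤ B)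
    {M N : Set G} (hNM : ∀ z ∈ N, ∀ u : G, ⁅z, u⁆ ∈ M) (hM : B ⊓ 𝓟 M ≤ A) (hN : B ≤ A * 𝓟 N) :
    Tendsto (fun p : G × G => p.1 * p.2 * p.1⁻¹) (B ×ˢ A) A := by
  -- A `B`-small element is `x * z` with `x` an `A`-small element and `z ∈ N`. Conjugation by it is
  -- `u ↦ x * (⁅z, u⁆ * u) * x⁻¹`, and `⁅z, u⁆` is both `B`-small and in `M`, hence `A`-small.
  rw [← inf_eq_right.2 hN, filter_mul_inf_eq_map, ← map_id (f := A), prod_map_map_eq,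
    tendsto_map'_iff]
  set l := (A ×ˢ 𝓟 N ⊓ comap (fun p : G × G => p.1 * p.2) B) ×ˢ A
  have hx : Tendsto (fun q : (G × G) × G => q.1.1) l A :=
    (tendsto_fst.mono_left inf_le_left).comp tendsto_fst
  have hz : ∀ᶠ q : (G × G) × G in l, q.1.2 ∈ N :=
    ((tendsto_snd.mono_left inf_le_left).comp tendsto_fst).eventually (mem_principal_self N)
  have hxz : Tendsto (fun q : (G × G) × G => q.1.1 * q.1.2) l B :=
    (tendsto_comap.mono_left inf_le_right).comp tendsto_fst
  have hu : Tendsto (fun q : (G × G) × G => q.2) l A := tendsto_snd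
  have hzB : Tendsto (fun q : (G × G) × G => q.1.2) l B := by
    simpa only [inv_mul_cancel_left] using
      hB.tendsto_mul (hB.tendsto_inv (hx.mono_right hAB)) hxz
  have hcomm : Tendsto (fun q : (G × G) × G => ⁅q.1.2, q.2⁆) l A :=
    (tendsto_inf.2 ⟨hB.tendsto_commutator hzB (hu.mono_right hAB),
      tendsto_principal.2 (hz.mono fun q hq => hNM _ hq q.2)⟩).mono_right hM
  refine (hA.tendsto_mul (hA.tendsto_mul hx (hA.tendsto_mul hcomm hu))
    (hA.tendsto_inv hx)).congr fun q => ?_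
  simp [commutatorElement_def, mul_assoc]

end IsGroupFilter

theorem exists_le_mul_upperCentralSeries_succ {G : Type*} [Group G] [Group.IsNilpotent G]
    {A B : Filter G} (hA : 1 ≤ A) (hBA : ¬B ≤ A) :
    ∃ n : ℕ, ¬B ≤ A * 𝓟 (Subgroup.upperCentralSeries G n : Set G) ∧
      B ≤ A * 𝓟 (Subgroup.upperCentralSeries G (n + 1) : Set G) := by
  refine Nat.exists_not_and_succ_of_not_zero_of_exists (by simpa using hBA) ?_
  obtain ⟨n, hn⟩ := Group.IsNilpotent.nilpotent G
  refine ⟨n, ?_⟩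
  rw [hn, Subgroup.coe_top, principal_univ, Filter.mul_top_of_one_le hA]
  exact le_top

namespace GroupTopologyLattice

variable {G : Type*} [Group G]

/-- The filter of neighbourhoods of `1` in a group topology. -/
def nhdsOne (σ : GroupTopologyLattice G) : Filter G :=
  @nhds G (OrderDual.ofDual σ).toTopologicalSpace 1

theorem isGroupFilter_nhdsOne (σ : GroupTopologyLattice G) : IsGroupFilter σ.nhdsOne := by
  let := (OrderDual.ofDual σ).toTopologicalSpace
  have := (OrderDual.ofDual σ).toIsTopologicalGroup
  change IsGroupFilter (𝓝 (1 : G))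
  refine ⟨pure_le_nhds 1, (nhds_mul_nhds_one 1).le, (nhds_one_symm' (G := G)).le, fun g => ?_⟩
  have hconj : Continuous fun x : G => g * x * g⁻¹ := by fun_prop
  simpa only [mul_one, mul_inv_cancel] using hconj.tendsto 1

theorem nhdsOne_le_nhdsOne_iff {σ τ : GroupTopologyLattice G} :
    τ.nhdsOne ≤ σ.nhdsOne ↔ σ ≤ τ := by
  have := (OrderDual.ofDual σ).toIsTopologicalGroup
  have := (OrderDual.ofDual τ).toIsTopologicalGroup
  rw [← OrderDual.ofDual_le_ofDual, ← GroupTopology.toTopologicalSpace_le]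
  refine ⟨fun h => le_of_nhds_le_nhds fun x => ?_, fun h => nhds_mono h⟩
  rw [← @map_mul_left_nhds_one G (OrderDual.ofDual σ).toTopologicalSpace _ _ x,
    ← @map_mul_left_nhds_one G (OrderDual.ofDual τ).toTopologicalSpace _ _ x]
  exact map_mono h

theorem nhdsOne_injective : Function.Injective (nhdsOne (G := G)) := fun _ _ h =>
  le_antisymm (nhdsOne_le_nhdsOne_iff.1 h.ge) (nhdsOne_le_nhdsOne_iff.1 h.le)

theorem nhdsOne_sup (σ τ : GroupTopologyLattice G) :
    (σ ⊔ τ).nhdsOne = σ.nhdsOne ⊓ τ.nhdsOne :=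
  nhds_inf

theorem exists_nhdsOne_eq {F : Filter G} (hF : IsGroupFilter F) :
    ∃ σ : GroupTopologyLattice G, σ.nhdsOne = F := by
  let B : GroupFilterBasis G :=
    { sets := F.sets
      nonempty := ⟨univ, univ_mem⟩
      inter_sets := fun {x y} hx hy => ⟨x ∩ y, inter_mem hx hy, subset_rfl⟩
      one' := fun hU => mem_pure.1 (hF.one_le hU)
      mul' := fun {U} hU => by
        obtain ⟨V, hV, W, hW, hVW⟩ := Filter.mem_mul.1 (hF.mul_le hU)
        exact ⟨V ∩ W, inter_mem hV hW,
          (Set.mul_subset_mul inter_subset_left inter_subset_right).trans hVW⟩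
      inv' := fun {U} hU => ⟨_, hF.inv_le hU, subset_rfl⟩
      conj' := fun g {U} hU => ⟨_, hF.tendsto_conj g hU, subset_rfl⟩ }
  refine ⟨OrderDual.toDual ⟨B.topology, B.isTopologicalGroup⟩, B.nhds_one_eq.trans ?_⟩
  ext U
  rw [FilterBasis.mem_filter_iff]
  exact ⟨fun ⟨V, hV, hVU⟩ => mem_of_superset hV hVU, fun h => ⟨U, h, subset_rfl⟩⟩

theorem nhdsOne_eq_or_eq_of_covBy {σ τ : GroupTopologyLattice G} (h : σ ⋖ τ) {F : Filter G}
    (hF : IsGroupFilter F) (hτ : τ.nhdsOne ≤ F) (hσ : F ≤ σ.nhdsOne) :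
    F = σ.nhdsOne ∨ F = τ.nhdsOne := by
  obtain ⟨ρ, rfl⟩ := exists_nhdsOne_eq hF
  rw [nhdsOne_injective.eq_iff, nhdsOne_injective.eq_iff]
  exact h.eq_or_eq (nhdsOne_le_nhdsOne_iff.1 hσ) (nhdsOne_le_nhdsOne_iff.1 hτ)

theorem tendsto_conj_prod_of_covBy [Group.IsNilpotent G] {σ τ : GroupTopologyLattice G}
    (h : σ ⋖ τ) :
    Tendsto (fun p : G × G => p.1 * p.2 * p.1⁻¹) (σ.nhdsOne ×ˢ τ.nhdsOne) τ.nhdsOne := by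
  have hσ := σ.isGroupFilter_nhdsOne
  have hτ := τ.isGroupFilter_nhdsOne
  have hle : τ.nhdsOne ≤ σ.nhdsOne := nhdsOne_le_nhdsOne_iff.2 h.le
  obtain ⟨n, hn, hn'⟩ := exists_le_mul_upperCentralSeries_succ hτ.one_le
    (mt nhdsOne_le_nhdsOne_iff.1 h.lt.not_ge : ¬σ.nhdsOne ≤ τ.nhdsOne)
  set M := Subgroup.upperCentralSeries G n
  have hinf : σ.nhdsOne ⊓ τ.nhdsOne * 𝓟 (M : Set G) = τ.nhdsOne :=
    (nhdsOne_eq_or_eq_of_covBy h (hσ.inf (hτ.mul_principal M))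
      (le_inf hle (le_mul_of_one_le_right' (IsGroupFilter.principal M).one_le))
      inf_le_left).resolve_left fun heq => hn (inf_eq_left.1 heq)
  have hM : σ.nhdsOne ⊓ 𝓟 (M : Set G) ≤ τ.nhdsOne :=
    (inf_le_inf_left _ (le_mul_of_one_le_left' hτ.one_le)).trans hinf.le
  exact hτ.tendsto_conj_prod hσ hle
    (fun _ hz u => Subgroup.mem_upperCentralSeries_succ_iff.1 hz u) hM hn'

theorem isSemimodularLattice [Group.IsNilpotent G] :
    IsSemimodularLattice (GroupTopologyLattice G) := by
  intro a b c h
  refine wcovBy_of_eq_or_eq (sup_le_sup_right h.le c) fun d hbd hda => ?_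
  obtain ⟨hb, hc⟩ := sup_le_iff.1 hbd
  have hdb := nhdsOne_le_nhdsOne_iff.2 hb
  have hdc := nhdsOne_le_nhdsOne_iff.2 hc
  have hd := d.isGroupFilter_nhdsOne
  have hprod : IsGroupFilter (d.nhdsOne * a.nhdsOne) :=
    hd.mul a.isGroupFilter_nhdsOne
      ((tendsto_conj_prod_of_covBy h).mono_left (prod_mono_left _ hdb))
  rcases nhdsOne_eq_or_eq_of_covBy h hprod (le_mul_of_one_le_left' hd.one_le)
    ((mul_le_mul' hdb (nhdsOne_le_nhdsOne_iff.2 h.le)).trans b.isGroupFilter_nhdsOne.mul_le)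
    with heq | heq
  · refine .inl <| le_antisymm (nhdsOne_le_nhdsOne_iff.1 ?_) hbd
    calc (b ⊔ c).nhdsOne = d.nhdsOne * a.nhdsOne ⊓ c.nhdsOne := by rw [nhdsOne_sup, heq]
      _ ≤ d.nhdsOne * (a.nhdsOne ⊓ c.nhdsOne) :=
        c.isGroupFilter_nhdsOne.mul_inf_le_mul_inf hdc
      _ = d.nhdsOne * (a ⊔ c).nhdsOne := by rw [nhdsOne_sup]
      _ ≤ d.nhdsOne * d.nhdsOne := mul_le_mul_right (nhdsOne_le_nhdsOne_iff.2 hda) _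
      _ ≤ d.nhdsOne := hd.mul_le
  · have had : a ≤ d := nhdsOne_le_nhdsOne_iff.1
      ((le_mul_of_one_le_right' a.isGroupFilter_nhdsOne.one_le).trans_eq heq)
    exact .inr <| le_antisymm hda (sup_le had hc)

end GroupTopologyLattice

theorem IsSemimodularLattice.isUpperModularLattice {L : Type*} [Lattice L]
    (hL : IsSemimodularLattice L) : IsUpperModularLattice L where
  covBy_sup_of_inf_covBy {a b} h := by
    have hcov : b ⩿ a ⊔ b := by
      simpa only [sup_eq_right.2 (inf_le_right : a ⊓ b ≤ b)] using hL a (a ⊓ b) b h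
    refine hcov.covBy_of_not_le fun hle => h.lt.ne ?_
    exact inf_eq_left.2 (le_sup_left.trans hle)

/-- The structure of a Jordan-Hölder lattice on the dual of a weakly upper modular lattice. It is
stated for the dual because the axioms of `JordanHolderLattice` are those of lower modularity. -/
abbrev jordanHolderLatticeDual (L : Type*) [Lattice L] [IsWeakUpperModularLattice L] :
    JordanHolderLattice Lᵒᵈ where
  IsMaximal x y := OrderDual.ofDual y ⋖ OrderDual.ofDual x
  lt_of_isMaximal h := h.lt
  sup_eq_of_isMaximal hx hy hne := hx.toDual.wcovBy.sup_eq hy.toDual.wcovBy hne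
  isMaximal_inf_left_of_isMaximal_sup hx hy := hx.sup_of_inf_of_inf_left hy

theorem covBy_series_length_eq {L : Type*} [Lattice L] [IsWeakUpperModularLattice L]
    {s t : RelSeries {(x, y) : L × L | x ⋖ y}} (hhead : s.head = t.head)
    (hlast : s.last = t.last) : s.length = t.length := by
  let _ := jordanHolderLatticeDual L
  let s' : CompositionSeries Lᵒᵈ := s.reverse
  let t' : CompositionSeries Lᵒᵈ := t.reverse
  have hhead' : s'.head = t'.head :=
    s.head_reverse.trans (hlast.trans t.head_reverse.symm)
  have hlast' : s'.last = t'.last :=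
    s.last_reverse.trans (hhead.trans t.last_reverse.symm)
  exact (CompositionSeries.jordan_holder s' t' hhead' hlast').length_eq

section NonRefinableChain

variable {P : Type*} [PartialOrder P] {a b : P} {C : Set P}

theorem IsNonRefinableChain.covBy_coe (hC : IsNonRefinableChain C) {x y : C} (h : x ⋖ y) :
    (x : P) ⋖ y := by
  refine ⟨h.lt, fun z hxz hzy => ?_⟩
  have hchain : IsChain (· ≤ ·) (insert z C) := hC.1.insert fun c hc _ => by
    rcases hC.1.total hc x.2 with hcx | hxc
    · exact .inr (hcx.trans hxz.le)
    rcases hC.1.total hc y.2 with hcy | hyc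
    · rcases h.eq_or_eq (c := ⟨c, hc⟩) hxc hcy with rfl | rfl
      · exact .inr hxz.le
      · exact .inl hzy.le
    · exact .inl (hzy.le.trans hyc)
  have hrefines : Refines (insert z C) C := by
    refine ⟨subset_insert z C, ?_⟩
    rintro c (rfl | hc)
    · exact ⟨x, x.2, y, y.2, hxz.le, hzy.le⟩
    · exact ⟨c, hc, c, hc, le_rfl, le_rfl⟩
  have hz : z ∈ C := hC.2 _ hchain hrefines ▸ mem_insert z C
  exact h.2 (show x < ⟨z, hz⟩ from hxz) hzy

theorem IsNonRefinableChainBetween.exists_covBy_series (h : IsNonRefinableChainBetween a b C)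
    (hfin : C.Finite) : ∃ s : RelSeries {(x, y) : P × P | x ⋖ y},
      s.head = a ∧ s.last = b ∧ s.length = chainLength C := by
  classical
  obtain ⟨hC, ha, hb⟩ := h
  have := hfin.fintype
  let := hC.1.linearOrder
  have hcard : Fintype.card C = chainLength C + 1 := by
    have := (Set.ncard_pos hfin).2 ⟨a, ha.1⟩
    rw [Fintype.card_eq_nat_card, Nat.card_coe_set_eq, chainLength]
    omega
  let e := Fintype.orderIsoFinOfCardEq C hcard
  refine ⟨⟨chainLength C, fun i => e i, fun i => hC.covBy_coe ?_⟩, ?_, ?_, rfl⟩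
  · exact (apply_covBy_apply_iff e).2 (by simp)
  · have he : IsLeast C (e 0) := ⟨(e 0).2, fun c hc => by
      have := e.monotone (Fin.zero_le (e.symm ⟨c, hc⟩))
      rwa [e.apply_symm_apply] at this⟩
    exact he.unique ha
  · have he : IsGreatest C (e (Fin.last _)) := ⟨(e _).2, fun c hc => by
      have := e.monotone (Fin.le_last (e.symm ⟨c, hc⟩))
      rwa [e.apply_symm_apply] at this⟩
    exact he.unique hb

end NonRefinableChain

theorem mainTheorem3 (G : Type*) [Group G] [Group.IsNilpotent G] :
    IsSemimodularLattice (GroupTopologyLattice G) ∧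
      ∀ (a b : GroupTopologyLattice G) (C D : Set (GroupTopologyLattice G)),
        C.Finite → D.Finite →
        IsNonRefinableChainBetween a b C → IsNonRefinableChainBetween a b D →
        chainLength C = chainLength D := by
  have hL : IsSemimodularLattice (GroupTopologyLattice G) :=
    GroupTopologyLattice.isSemimodularLattice
  have := hL.isUpperModularLattice
  refine ⟨hL, fun a b C D hC hD hCab hDab => ?_⟩
  obtain ⟨s, hsa, hsb, hs⟩ := hCab.exists_covBy_series hC
  obtain ⟨t, hta, htb, ht⟩ := hDab.exists_covBy_series hD
  rw [← hs, ← ht]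
  exact covBy_series_length_eq (hsa.trans hta.symm) (hsb.trans htb.symm)
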